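/- Let $n\ge 1$ be an integer and let $f$ be analytic in a complex domain (connected open set) $D\subseteq\mathbb{C}$ containing the closed interval $[0,1]$. Let $C$ be a closed, piecewise continuously differentiable path in $D\setminus[0,1]$ that encircles $[0,1]$ once in the positive sense, i.e. whose winding number around every point of $[0,1]$ is $1$, and that encircles no point outside $D$, i.e. whose winding number around every $w\notin D$ is $0$ (automatic if $D$ is simply connected, and satisfied by every closed curve whose interior lies in $D$). Then the Hadamard finite-part integral $$\mathrm{f.p.}\!\int_0^1 x^{-n}f(x)\,dx := \lim_{\epsilon\downarrow 0}\left\{\int_\epsilon^1 x^{-n}f(x)\,dx-\sum_{k=0}^{n-2}\frac{\epsilon^{k+1-n}}{k!\,(n-1-k)}f^{(k)}(0)+\frac{\log\epsilon}{(n-1)!}f^{(n-1)}(0)\right\}$$ exists and $$\mathrm{f.p.}\!\int_0^1 x^{-n}f(x)\,dx=\frac{1}{2\pi i}\oint_C z^{-n}f(z)\log\left(\frac{z}{z-1}\right)dz-\sum_{k=0}^{n-2}\frac{f^{(k)}(0)}{k!\,(n-1-k)},$$ where $\log$ is the principal branch (so that $\log(z/(z-1))$ is analytic on $\mathbb{C}\setminus[0,1]$)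 and both sums are zero if $n=1$. -/

import Mathlib

open Set Filter Topology MeasureTheory

/-- `γ` is piecewise continuously differentiable: `[0, 1]` has a finite partition on each closed
piece of which `γ` is `C¹` (with one-sided derivatives at the end points of the piece). -/
def PiecewiseC1 {a b : ℂ} (γ : Path a b) : Prop :=
  ∃ (N : ℕ) (t : ℕ → ℝ), t 0 = 0 ∧ t N = 1 ∧ (∀ i < N, t i < t (i + 1)) ∧
    ∀ i < N, ContDiffOn ℝ 1 γ.extend (Icc (t i) (t (i + 1)))

/-- The complex line integral `∫_γ F(z) dz`, that is, the integral along `γ` of the 1-form which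
at the point `z` is the linear map `h ↦ h * F z`. -/
noncomputable def contourIntegral (F : ℂ → ℂ) {a b : ℂ} (γ : Path a b) : ℂ :=
  curveIntegral (fun z : ℂ => ContinuousLinearMap.toSpanSingleton ℂ (F z)) γ

/-- The winding number `(1 / 2πi) ∮_γ dz / (z - w)` of a closed path around a point `w` that does
not lie on it. -/
noncomputable def windingNumber {a : ℂ} (γ : Path a a) (w : ℂ) : ℂ :=
  (2 * Real.pi * Complex.I)⁻¹ * contourIntegral (fun z => (z - w)⁻¹) γ

/-- The closed path `γ` encircles the interval `[0, 1]` (once) in the positive sense: it does not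
meet the interval and it winds exactly once, counterclockwise, around each of its points. -/
def EncirclesUnitInterval {a : ℂ} (γ : Path a a) : Prop :=
  ∀ x ∈ Icc (0 : ℝ) 1, (x : ℂ) ∉ range γ ∧ windingNumber γ (x : ℂ) = 1

/-- The Hadamard finite-part integral `f.p. ∫₀¹ x⁻ⁿ f(x) dx` (for `n ≥ 1` and `f` analytic on
`[0, 1]`) exists and equals `I`: as `ε ↓ 0`,
`∫_ε^1 x⁻ⁿ f(x) dx - ∑_{k=0}^{n-2} ε^{k+1-n} f⁽ᵏ⁾(0) / (k! (n-1-k)) + log ε f⁽ⁿ⁻¹⁾(0) / (n-1)!`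
tends to `I`. -/
def HasFinitePartIntegral (n : ℕ) (f : ℂ → ℂ) (I : ℂ) : Prop :=
  Tendsto (fun ε : ℝ =>
      (∫ x in ε..1, (x : ℂ) ^ (-(n : ℤ)) * f (x : ℂ))
        - ∑ k ∈ Finset.range (n - 1),
            (ε : ℂ) ^ ((k : ℤ) + 1 - (n : ℤ)) / ((k.factorial : ℂ) * ((n : ℂ) - 1 - (k : ℂ)))
              * iteratedDeriv k f 0
        + (Real.log ε : ℂ) / ((n - 1).factorial : ℂ) * iteratedDeriv (n - 1) f 0)
    (𝓝[>] 0) (𝓝 I)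

/-! Write `f z = P z + z ^ n * F z` with `P` the Taylor polynomial of degree `n - 1` at `0`; then
`F` is holomorphic on all of `D`. Both sides of the formula reduce to `∫₀¹ F` minus the same finite
sum. On the finite-part side (`hasFinitePartIntegral_of_taylor`) the powers from `P` integrate
explicitly: their `ε`-dependent parts are exactly the counterterms, and their values at `1` give the
finite sum. On the contour side, `log (z / (z - 1)) = ∫₀¹ dx / (z - x)`
(`integral_inv_sub_ofReal_eq_log`), and Fubini leaves the inner integral `∮ z⁻ⁿ f(z) / (z - x) dz`
for `0 < x ≤ 1`. The terms of `P` contribute nothing, since the curve winds equally around `0` and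
`x` (`contourIntegral_inv_sub_mul_inv_pow`); the `F` term gives `2πi F(x)` by the global Cauchy
formula (`contourIntegral_inv_sub_mul`), proved by Dixon's argument. -/

/-! ### Calculus of contour integrals along piecewise `C¹` paths. -/

section Curve

variable {a b : ℂ} {γ : Path a b}

theorem contourIntegral_eq_intervalIntegral (F : ℂ → ℂ) (γ : Path a b) :
    contourIntegral F γ = ∫ t in (0 : ℝ)..1, F (γ.extend t) * deriv γ.extend t := by
  rw [contourIntegral, curveIntegral_eq_intervalIntegral_deriv]
  simp [mul_comm]

theorem Path.extend_mem_range (γ : Path a b) (t : ℝ) : γ.extend t ∈ range γ := by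
  rw [← γ.extend_range]; exact mem_range_self t

theorem contourIntegral_congr {F G : ℂ → ℂ} (h : EqOn F G (range γ)) :
    contourIntegral F γ = contourIntegral G γ := by
  simp only [contourIntegral_eq_intervalIntegral, h (γ.extend_mem_range _)]

theorem contourIntegral_const_mul (c : ℂ) (F : ℂ → ℂ) :
    contourIntegral (fun z => c * F z) γ = c * contourIntegral F γ := by
  simp only [contourIntegral_eq_intervalIntegral, mul_assoc]
  exact intervalIntegral.integral_const_mul _ _

theorem PiecewiseC1.exists_countable_differentiableAt (h : PiecewiseC1 γ) :
    ∃ s : Set ℝ, s.Countable ∧ ∀ t ∈ Ioo (0 : ℝ) 1 \ s, DifferentiableAt ℝ γ.extend t := by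
  obtain ⟨N, t, h0, h1, hlt, hd⟩ := h
  refine ⟨range t, countable_range t, fun x ⟨hx, hxt⟩ => ?_⟩
  have key : ∀ k ≤ N, x < t k → DifferentiableAt ℝ γ.extend x := by
    intro k
    induction k with
    | zero => intro _ hk; rw [h0] at hk; exact absurd hx.1 (not_lt.2 hk.le)
    | succ k ih =>
      intro hkN hk
      rcases lt_trichotomy x (t k) with hl | he | hg
      · exact ih (by omega) hl
      · exact absurd ⟨k, he.symm⟩ hxt
      · exact ((hd k (by omega)).differentiableOn (by norm_num)).differentiableAt
          (Icc_mem_nhds hg hk)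
  exact key N le_rfl (h1 ▸ hx.2)

theorem PiecewiseC1.intervalIntegrable_deriv (h : PiecewiseC1 γ) :
    IntervalIntegrable (deriv γ.extend) volume 0 1 := by
  obtain ⟨N, t, h0, h1, hlt, hd⟩ := h
  rw [← h0, ← h1]
  refine IntervalIntegrable.trans_iterate fun k hk => ?_
  have hc : ContinuousOn (derivWithin γ.extend (Icc (t k) (t (k + 1)))) (Icc (t k) (t (k + 1))) :=
    (hd k hk).continuousOn_derivWithin (uniqueDiffOn_Icc (hlt k hk)) le_rfl
  have hi := hc.intervalIntegrable_of_Icc (μ := volume) (hlt k hk).le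
  rw [intervalIntegrable_iff_integrableOn_Ioo_of_le (hlt k hk).le] at hi ⊢
  refine hi.congr_fun (fun x hx => ?_) measurableSet_Ioo
  exact derivWithin_of_mem_nhds (Icc_mem_nhds hx.1 hx.2)

theorem ContinuousOn.comp_path_extend {F : ℂ → ℂ} (hF : ContinuousOn F (range γ)) :
    Continuous fun t => F (γ.extend t) :=
  hF.comp_continuous γ.continuous_extend γ.extend_mem_range

theorem PiecewiseC1.intervalIntegrable (h : PiecewiseC1 γ) {F : ℂ → ℂ}
    (hF : ContinuousOn F (range γ)) :
    IntervalIntegrable (fun t => F (γ.extend t) * deriv γ.extend t) volume 0 1 :=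
  h.intervalIntegrable_deriv.continuousOn_mul hF.comp_path_extend.continuousOn

theorem PiecewiseC1.contourIntegral_add (h : PiecewiseC1 γ) {F G : ℂ → ℂ}
    (hF : ContinuousOn F (range γ)) (hG : ContinuousOn G (range γ)) :
    contourIntegral (fun z => F z + G z) γ = contourIntegral F γ + contourIntegral G γ := by
  simp only [contourIntegral_eq_intervalIntegral, add_mul]
  exact intervalIntegral.integral_add (h.intervalIntegrable hF) (h.intervalIntegrable hG)

theorem PiecewiseC1.contourIntegral_sub (h : PiecewiseC1 γ) {F G : ℂ → ℂ}
    (hF : ContinuousOn F (range γ)) (hG : ContinuousOn G (range γ)) :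
    contourIntegral (fun z => F z - G z) γ = contourIntegral F γ - contourIntegral G γ := by
  simp only [contourIntegral_eq_intervalIntegral, sub_mul]
  exact intervalIntegral.integral_sub (h.intervalIntegrable hF) (h.intervalIntegrable hG)

theorem PiecewiseC1.contourIntegral_sum (h : PiecewiseC1 γ) {ι : Type*} (s : Finset ι)
    {F : ι → ℂ → ℂ} (hF : ∀ i ∈ s, ContinuousOn (F i) (range γ)) :
    contourIntegral (fun z => ∑ i ∈ s, F i z) γ = ∑ i ∈ s, contourIntegral (F i) γ := by
  simp only [contourIntegral_eq_intervalIntegral, Finset.sum_mul]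
  exact intervalIntegral.integral_finsetSum fun i hi => h.intervalIntegrable (hF i hi)

theorem PiecewiseC1.contourIntegral_eq_sub_of_hasDerivAt (h : PiecewiseC1 γ) {F G : ℂ → ℂ}
    (hG : ∀ z ∈ range γ, HasDerivAt G (F z) z) (hF : ContinuousOn F (range γ)) :
    contourIntegral F γ = G b - G a := by
  obtain ⟨s, hs, hd⟩ := h.exists_countable_differentiableAt
  have := integral_eq_of_hasDerivAt_off_countable_of_le (fun t => G (γ.extend t))
    (fun t => F (γ.extend t) * deriv γ.extend t) zero_le_one hs
    (ContinuousOn.comp_path_extend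
      fun z hz => (hG z hz).continuousAt.continuousWithinAt).continuousOn
    (fun t ht => by
      simpa [mul_comm] using! (hG _ (γ.extend_mem_range t)).scomp t (hd t ht).hasDerivAt)
    (h.intervalIntegrable hF)
  simpa [contourIntegral_eq_intervalIntegral] using this

theorem PiecewiseC1.exists_norm_contourIntegral_le (h : PiecewiseC1 γ) :
    ∃ K : ℝ, 0 ≤ K ∧ ∀ (F : ℂ → ℂ) (M : ℝ), (∀ z ∈ range γ, ‖F z‖ ≤ M) →
      ‖contourIntegral F γ‖ ≤ M * K := by
  refine ⟨∫ t in (0 : ℝ)..1, ‖deriv γ.extend t‖,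
    intervalIntegral.integral_nonneg zero_le_one fun _ _ => norm_nonneg _, fun F M hM => ?_⟩
  rw [contourIntegral_eq_intervalIntegral, ← intervalIntegral.integral_const_mul]
  refine intervalIntegral.norm_integral_le_of_norm_le zero_le_one (.of_forall fun t _ => ?_)
    (h.intervalIntegrable_deriv.norm.const_mul M)
  rw [norm_mul]
  exact mul_le_mul_of_nonneg_right (hM _ (γ.extend_mem_range t)) (norm_nonneg _)

theorem PiecewiseC1.contourIntegral_intervalIntegral_swap (h : PiecewiseC1 γ) {φ : ℝ → ℂ → ℂ}
    (hφ : ContinuousOn (Function.uncurry φ) (Icc 0 1 ×ˢ range γ)) :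
    contourIntegral (fun z => ∫ x in (0 : ℝ)..1, φ x z) γ =
      ∫ x in (0 : ℝ)..1, contourIntegral (φ x) γ := by
  simp only [contourIntegral_eq_intervalIntegral, ← intervalIntegral.integral_mul_const]
  refine intervalIntegral_intervalIntegral_swap ?_
  rw [uIoc_of_le zero_le_one]
  have hcont : ContinuousOn (fun p : ℝ × ℝ => φ p.2 (γ.extend p.1)) (Icc 0 1 ×ˢ Icc 0 1) :=
    hφ.comp (f := fun p : ℝ × ℝ => (p.2, γ.extend p.1))
      (continuous_snd.prodMk (γ.continuous_extend.comp continuous_fst)).continuousOn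
      fun p hp => ⟨hp.2, γ.extend_mem_range _⟩
  obtain ⟨M, hM⟩ := (isCompact_Icc.prod isCompact_Icc).exists_bound_of_continuousOn hcont
  have hsub : Ioc (0 : ℝ) 1 ×ˢ Ioc (0 : ℝ) 1 ⊆ Icc 0 1 ×ˢ Icc 0 1 :=
    prod_mono Ioc_subset_Icc_self Ioc_subset_Icc_self
  have hms : MeasurableSet (Ioc (0 : ℝ) 1 ×ˢ Ioc (0 : ℝ) 1) := 
    measurableSet_Ioc.prod measurableSet_Ioc
  refine Integrable.bdd_mul (f := fun p : ℝ × ℝ => φ p.2 (γ.extend p.1))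
    (g := fun p : ℝ × ℝ => deriv γ.extend p.1) (c := M) ?_
    ((hcont.mono hsub).aestronglyMeasurable hms)
    ((ae_restrict_iff' hms).2 (.of_forall fun p hp => hM p (hsub hp)))
  rw [Measure.volume_eq_prod, ← Measure.prod_restrict]
  exact h.intervalIntegrable_deriv.1.integrable.comp_fst _

/-- Differentiation under a contour integral: it is enough that the integrand is holomorphic in the
parameter and locally bounded. -/
theorem PiecewiseC1.hasDerivAt_contourIntegral (h : PiecewiseC1 γ) {φ : ℂ → ℂ → ℂ} {w₀ : ℂ}
    {r M : ℝ} (hr : 0 < r) (hc : ∀ w ∈ Metric.ball w₀ r, ContinuousOn (φ w) (range γ))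
    (hd : ∀ z ∈ range γ, DifferentiableOn ℂ (fun w => φ w z) (Metric.ball w₀ r))
    (hM : ∀ w ∈ Metric.ball w₀ r, ∀ z ∈ range γ, ‖φ w z‖ ≤ M) :
    HasDerivAt (fun w => contourIntegral (φ w) γ)
      (contourIntegral (fun z => deriv (fun w => φ w z) w₀) γ) w₀ := by
  simp only [contourIntegral_eq_intervalIntegral]
  have hr2 : 0 < r / 2 := by positivity
  have hsub : Metric.ball w₀ (r / 2) ⊆ Metric.ball w₀ r := Metric.ball_subset_ball (by linarith)
  have hda : ∀ z ∈ range γ, ∀ w ∈ Metric.ball w₀ r,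
      HasDerivAt (fun w => φ w z) (deriv (fun w => φ w z) w) w := fun z hz w hw =>
    ((hd z hz).differentiableAt (Metric.isOpen_ball.mem_nhds hw)).hasDerivAt
  refine (intervalIntegral.hasDerivAt_integral_of_dominated_loc_of_deriv_le
    (F := fun w t => φ w (γ.extend t) * deriv γ.extend t)
    (F' := fun w t => deriv (fun w => φ w (γ.extend t)) w * deriv γ.extend t)
    (bound := fun t => M / (r / 4) * ‖deriv γ.extend t‖)
    (Metric.ball_mem_nhds w₀ hr2) ?_ (h.intervalIntegrable (hc _ (Metric.mem_ball_self hr))) ?_ ?_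
    (h.intervalIntegrable_deriv.norm.const_mul _) ?_).2
  · filter_upwards [Metric.ball_mem_nhds w₀ hr] with w hw
    exact (h.intervalIntegrable (hc w hw)).aestronglyMeasurable_restrict_uIoc
  -- Measurability in `t` of the parameter derivative: it is a pointwise limit of continuous
  -- difference quotients along a sequence tending to `w₀`.
  · refine AEStronglyMeasurable.mul ?_ h.intervalIntegrable_deriv.aestronglyMeasurable_restrict_uIoc
    obtain ⟨u, hu⟩ := exists_seq_tendsto (𝓝[≠] w₀)
    have hu' : ∀ᶠ n in atTop, u n ∈ Metric.ball w₀ r :=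
      (tendsto_nhds_of_tendsto_nhdsWithin hu).eventually (Metric.ball_mem_nhds w₀ hr)
    obtain ⟨N, hN⟩ := eventually_atTop.1 hu'
    refine aestronglyMeasurable_of_tendsto_ae atTop
      (f := fun n t => slope (fun w => φ w (γ.extend t)) w₀ (u (n + N))) (fun n => ?_)
      (.of_forall fun t => ?_)
    · simp only [slope, vsub_eq_sub]
      exact (((hc _ (hN (n + N) (by omega))).comp_path_extend.sub
        (hc _ (Metric.mem_ball_self hr)).comp_path_extend).const_smul (u (n + N) - w₀)⁻¹).aestronglyMeasurable
    · exact ((hda _ (γ.extend_mem_range t) w₀ (Metric.mem_ball_self hr)).tendsto_slope.comp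
        hu).comp (tendsto_add_atTop_nat N)
  · refine .of_forall fun t _ w hw => ?_
    rw [norm_mul]
    refine mul_le_mul_of_nonneg_right ?_ (norm_nonneg _)
    -- Since `r / 2 + r / 4 < r`, Cauchy's estimate on this disc bounds the derivative by `M / (r /
    -- 4)`.
    have hcb : Metric.closedBall w (r / 4) ⊆ Metric.ball w₀ r := fun v hv => by
      have := dist_triangle v w w₀
      simp only [Metric.mem_closedBall, Metric.mem_ball] at hv hw ⊢
      linarith
    refine Complex.norm_deriv_le_of_forall_mem_sphere_norm_le (by positivity) ?_ ?_
    · exact ((hd _ (γ.extend_mem_range t)).mono (Metric.closure_ball_subset_closedBall.trans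
        hcb)).diffContOnCl
    · exact fun v hv => hM v (hcb (Metric.sphere_subset_closedBall hv)) _ (γ.extend_mem_range t)
  · exact .of_forall fun t _ w hw =>
      (hda _ (γ.extend_mem_range t) w (hsub hw)).mul_const _

end Curve

/-! ### Winding numbers and the global Cauchy theorem. -/

section Cauchy

variable {a b : ℂ} {γ : Path a b}

theorem Path.isCompact_range (γ : Path a b) : IsCompact (range γ) :=
  _root_.isCompact_range γ.continuous

theorem PiecewiseC1.hasDerivAt_cauchyTransform (h : PiecewiseC1 γ) {k : ℂ → ℂ}
    (hk : ContinuousOn k (range γ)) {w₀ : ℂ} (hw₀ : w₀ ∉ range γ) :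
    HasDerivAt (fun w => contourIntegral (fun z => (z - w)⁻¹ * k z) γ)
      (contourIntegral (fun z => ((z - w₀) ^ 2)⁻¹ * k z) γ) w₀ := by
  obtain ⟨ε, hε, hεγ⟩ :=
    Metric.isOpen_iff.1 γ.isCompact_range.isClosed.isOpen_compl w₀ hw₀
  obtain ⟨B, hB⟩ := γ.isCompact_range.exists_bound_of_continuousOn hk
  have hfar : ∀ w ∈ Metric.ball w₀ (ε / 2), ∀ z ∈ range γ, ε / 2 ≤ ‖z - w‖ := by
    intro w hw z hz
    by_contra! hlt
    rw [Metric.mem_ball] at hw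
    rw [← dist_eq_norm] at hlt
    exact hεγ (Metric.mem_ball.2 (by linarith [dist_triangle z w w₀])) hz
  have hne : ∀ w ∈ Metric.ball w₀ (ε / 2), ∀ z ∈ range γ, z - w ≠ 0 := fun w hw z hz =>
    norm_pos_iff.1 ((half_pos hε).trans_le (hfar w hw z hz))
  have hder : ∀ w ∈ Metric.ball w₀ (ε / 2), ∀ z ∈ range γ,
      HasDerivAt (fun w => (z - w)⁻¹ * k z) (((z - w) ^ 2)⁻¹ * k z) w := by
    intro w hw z hz
    have := (((hasDerivAt_id w).const_sub z).fun_inv (hne w hw z hz)).mul_const (k z)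
    simpa [div_eq_mul_inv] using this
  have hw₀' := Metric.mem_ball_self (x := w₀) (half_pos hε)
  have := h.hasDerivAt_contourIntegral (φ := fun w z => (z - w)⁻¹ * k z) (w₀ := w₀)
    (M := (ε / 2)⁻¹ * B) (half_pos hε)
    (fun w hw => ((continuousOn_id.sub continuousOn_const).inv₀ (hne w hw)).mul hk)
    (fun z hz w hw => (hder w hw z hz).differentiableAt.differentiableWithinAt)
    (fun w hw z hz => by
      rw [norm_mul, norm_inv]
      exact mul_le_mul (inv_anti₀ (half_pos hε) (hfar w hw z hz)) (hB z hz) (norm_nonneg _)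
        (by positivity))
  rwa [contourIntegral_congr fun z hz => (hder w₀ hw₀' z hz).deriv] at this

/-- The winding integral is locally constant off the curve: its derivative `∮ (z - w)⁻² dz` vanishes
because the integrand has a primitive. -/
theorem PiecewiseC1.isOpen_winding_eq_zero {γ : Path a a} (h : PiecewiseC1 γ) :
    IsOpen ((range γ)ᶜ ∩ {w | contourIntegral (fun z => (z - w)⁻¹) γ = 0}) := by
  have hder : ∀ w ∈ (range γ)ᶜ,
      HasDerivAt (fun w => contourIntegral (fun z => (z - w)⁻¹) γ) 0 w := by
    intro w hw
    have hne : ∀ z ∈ range γ, z - w ≠ 0 := fun z hz => sub_ne_zero.2 fun e => hw (e ▸ hz)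
    have h1 := h.hasDerivAt_cauchyTransform (k := fun _ => 1) continuousOn_const hw
    simp only [mul_one] at h1
    have hc : ContinuousOn (fun z => ((z - w) ^ 2)⁻¹) (range γ) :=
      ContinuousOn.inv₀ (by fun_prop) fun z hz => pow_ne_zero 2 (hne z hz)
    have hp : ∀ z ∈ range γ, HasDerivAt (fun z => -(z - w)⁻¹) ((z - w) ^ 2)⁻¹ z := fun z hz => by
      simpa [neg_div] using (((hasDerivAt_id z).sub_const w).fun_inv (hne z hz)).fun_neg
    rwa [h.contourIntegral_eq_sub_of_hasDerivAt hp hc, sub_self] at h1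
  exact γ.isCompact_range.isClosed.isOpen_compl.isOpen_inter_preimage_of_deriv_eq_zero
    (fun w hw => (hder w hw).differentiableAt.differentiableWithinAt)
    (fun w hw => (hder w hw).deriv) {0}

/-- Here `log (1 - z / w)` is a primitive along the curve, as `|z / w| < 1` keeps its argument in
the slit plane. -/
theorem PiecewiseC1.contourIntegral_inv_sub_eq_zero_of_norm_lt {γ : Path a a} (h : PiecewiseC1 γ)
    {w : ℂ} (hw : ∀ z ∈ range γ, ‖z‖ < ‖w‖) : contourIntegral (fun z => (z - w)⁻¹) γ = 0 := by
  have hne : ∀ z ∈ range γ, z - w ≠ 0 := fun z hz e => by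
    have := hw z hz
    rw [sub_eq_zero.1 e] at this
    exact this.false
  have hw0 : w ≠ 0 := norm_pos_iff.1 ((norm_nonneg a).trans_lt (hw a ⟨0, γ.source⟩))
  rw [h.contourIntegral_eq_sub_of_hasDerivAt (F := fun z => (z - w)⁻¹)
    (G := fun z => Complex.log (1 + -(z / w)))
    (fun z hz => ?_) ((continuousOn_id.sub continuousOn_const).inv₀ hne), sub_self]
  have hlt : ‖-(z / w)‖ < 1 := by
    rw [norm_neg, norm_div, div_lt_one (norm_pos_iff.2 hw0)]; exact hw z hz
  convert (((hasDerivAt_id' z).div_const w).fun_neg.const_add 1).clog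
    (Complex.mem_slitPlane_of_norm_lt_one hlt) using 1
  have : w - z ≠ 0 := by rw [← neg_sub]; exact neg_ne_zero.2 (hne z hz)
  have := hne z hz
  rw [show (1 : ℂ) + -(z / w) = (w - z) / w by field_simp; ring]
  field_simp
  ring

/-- Supplies the local bound for differentiating Dixon's integral in `w`. For `z` near `w₀` the mean
value inequality applies; otherwise `z - w` is bounded away from `0`. -/
theorem DifferentiableOn.exists_norm_dslope_le {D K : Set ℂ} {g : ℂ → ℂ}
    (hg : DifferentiableOn ℂ g D) (hD : IsOpen D) (hK : IsCompact K) (hKD : K ⊆ D) {w₀ : ℂ}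
    (hw₀ : w₀ ∈ D) : ∃ r > 0, ∃ M, Metric.ball w₀ r ⊆ D ∧
      ∀ w ∈ Metric.ball w₀ r, ∀ z ∈ K, ‖dslope g w z‖ ≤ M := by
  obtain ⟨ε, hε, hεD⟩ := Metric.nhds_basis_closedBall.mem_iff.1 (hD.mem_nhds hw₀)
  obtain ⟨B₁, hB₁⟩ := (isCompact_closedBall w₀ ε).exists_bound_of_continuousOn
    (((hg.analyticOnNhd hD).deriv.continuousOn).mono hεD)
  obtain ⟨B₂, hB₂⟩ := ((isCompact_closedBall w₀ ε).union hK).exists_bound_of_continuousOn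
    (hg.continuousOn.mono (union_subset hεD hKD))
  have hsub : Metric.ball w₀ (ε / 2) ⊆ Metric.closedBall w₀ ε :=
    (Metric.ball_subset_ball (by linarith)).trans Metric.ball_subset_closedBall
  refine ⟨ε / 2, half_pos hε, max B₁ ((ε / 2)⁻¹ * (B₂ + B₂)), hsub.trans hεD,
    fun w hw z hz => ?_⟩
  rcases eq_or_ne z w with rfl | hne
  · rw [dslope_same]; exact (hB₁ _ (hsub hw)).trans (le_max_left _ _)
  rw [dslope_of_ne _ hne, slope_def_module, norm_smul, norm_inv]
  have hpos : 0 < ‖z - w‖ := norm_pos_iff.2 (sub_ne_zero.2 hne)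
  by_cases hz' : z ∈ Metric.closedBall w₀ ε
  · refine le_trans ?_ (le_max_left _ _)
    rw [inv_mul_le_iff₀ hpos, mul_comm]
    exact (convex_closedBall w₀ ε).norm_image_sub_le_of_norm_deriv_le
      (fun x hx => hg.differentiableAt (hD.mem_nhds (hεD hx))) hB₁ (hsub hw) hz'
  · refine le_trans ?_ (le_max_right _ _)
    have hfar : ε / 2 ≤ ‖z - w‖ := by
      rw [Metric.mem_closedBall] at hz'
      rw [Metric.mem_ball] at hw
      rw [← dist_eq_norm]
      linarith [dist_triangle z w w₀]
    exact mul_le_mul (inv_anti₀ (half_pos hε) hfar) ((norm_sub_le _ _).trans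
      (add_le_add (hB₂ _ (.inr hz)) (hB₂ _ (.inl (hsub hw))))) (norm_nonneg _) (by positivity)

theorem contourIntegral_dslope_eq (h : PiecewiseC1 γ) {g : ℂ → ℂ}
    (hg : ContinuousOn g (range γ)) {w : ℂ} (hw : w ∉ range γ) :
    contourIntegral (dslope g w) γ = contourIntegral (fun z => (z - w)⁻¹ * g z) γ -
      g w * contourIntegral (fun z => (z - w)⁻¹) γ := by
  have hne : ∀ z ∈ range γ, z ≠ w := fun z hz e => hw (e ▸ hz)
  have hc : ContinuousOn (fun z => (z - w)⁻¹) (range γ) :=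
    (continuousOn_id.sub continuousOn_const).inv₀ fun z hz => sub_ne_zero.2 (hne z hz)
  rw [← contourIntegral_const_mul,
    ← h.contourIntegral_sub (F := fun z => (z - w)⁻¹ * g z) (G := fun z => g w * (z - w)⁻¹)
      (hc.mul hg) (continuousOn_const.mul hc)]
  refine contourIntegral_congr fun z hz => ?_
  rw [dslope_of_ne _ (hne z hz), slope_def_module, smul_eq_mul]
  ring

/-- Dixon's form of the global Cauchy theorem. -/
theorem contourIntegral_dslope_eq_zero {γ : Path a a} (h : PiecewiseC1 γ) {D : Set ℂ}
    (hD : IsOpen D) {g : ℂ → ℂ} (hg : DifferentiableOn ℂ g D) (hγD : range γ ⊆ D)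
    (hγ : ∀ w ∉ D, contourIntegral (fun z => (z - w)⁻¹) γ = 0) {w : ℂ} (hw : w ∈ D) :
    contourIntegral (dslope g w) γ = 0 := by
  classical
  have hgc : ContinuousOn g (range γ) := hg.continuousOn.mono hγD
  set U := (range γ)ᶜ ∩ {w | contourIntegral (fun z => (z - w)⁻¹) γ = 0} with hUdef
  have hU : IsOpen U := h.isOpen_winding_eq_zero
  have hDU : ∀ w ∉ D, w ∈ U := fun w hw => ⟨fun hw' => hw (hγD hw'), hγ w hw⟩
  -- The two formulas agree on `D ∩ U`, where the winding integral vanishes, and the open sets `D`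
  -- and `U` cover the plane. So `H` is entire; it tends to `0` at infinity, hence is zero by
  -- Liouville.
  set H : ℂ → ℂ := fun w => if w ∈ D then contourIntegral (dslope g w) γ
    else contourIntegral (fun z => (z - w)⁻¹ * g z) γ with hHdef
  have hHU : ∀ w ∈ U, H w = contourIntegral (fun z => (z - w)⁻¹ * g z) γ := by
    intro w hw
    by_cases hwD : w ∈ D
    · rw [hHdef]; simp only [hwD, if_true]
      rw [contourIntegral_dslope_eq h hgc hw.1, hw.2, mul_zero, sub_zero]
    · rw [hHdef]; simp only [hwD, if_false]
  have hHD : ∀ w ∈ D, H w = contourIntegral (dslope g w) γ := fun w hw => if_pos hw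
  have hdiff : Differentiable ℂ H := by
    intro w₀
    by_cases hw₀ : w₀ ∈ D
    · obtain ⟨r, hr, M, hrD, hM⟩ := hg.exists_norm_dslope_le hD γ.isCompact_range hγD hw₀
      refine DifferentiableAt.congr_of_eventuallyEq (h.hasDerivAt_contourIntegral hr
        (φ := dslope g) (M := M) (fun w hw => ?_) (fun z hz => ?_) hM).differentiableAt
        (Filter.eventually_of_mem (hD.mem_nhds hw₀) hHD)
      · exact ((continuousOn_dslope (hD.mem_nhds (hrD hw))).2 ⟨hg.continuousOn,
          hg.differentiableAt (hD.mem_nhds (hrD hw))⟩).mono hγD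
      -- Symmetry of the divided difference turns holomorphy in `z` into holomorphy in `w`.
      · have hsymm : (fun w => dslope g w z) = dslope g z := by
          ext w
          rcases eq_or_ne z w with rfl | hne
          · rfl
          · rw [dslope_of_ne _ hne, dslope_of_ne _ hne.symm, slope_comm]
        rw [hsymm]
        exact ((Complex.differentiableOn_dslope (hD.mem_nhds (hγD hz))).2 hg).mono hrD
    · exact (h.hasDerivAt_cauchyTransform hgc (hDU _ hw₀).1).differentiableAt.congr_of_eventuallyEq
        (Filter.eventually_of_mem (hU.mem_nhds (hDU _ hw₀)) hHU)
  obtain ⟨R, hR⟩ := γ.isCompact_range.isBounded.exists_norm_le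
  obtain ⟨B, hB⟩ := γ.isCompact_range.exists_bound_of_continuousOn hgc
  obtain ⟨K, hK0, hK⟩ := h.exists_norm_contourIntegral_le
  have hlim : Tendsto H (cocompact ℂ) (𝓝 0) := by
    have hbound : Tendsto (fun w : ℂ => (‖w‖ - R)⁻¹ * B * K) (cocompact ℂ) (𝓝 0) := by
      have := ((tendsto_inv_atTop_zero.comp (tendsto_atTop_add_const_right _ (-R)
        (tendsto_norm_cocompact_atTop (E := ℂ)))).mul_const B).mul_const K
      simpa [sub_eq_add_neg] using this
    refine squeeze_zero_norm' ?_ hbound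
    filter_upwards [(tendsto_norm_cocompact_atTop (E := ℂ)).eventually_gt_atTop R] with w hw
    have hfar : ∀ z ∈ range γ, ‖w‖ - R ≤ ‖z - w‖ := fun z hz => by
      rw [norm_sub_rev]
      linarith [norm_sub_norm_le w z, hR z hz]
    rw [hHU w ⟨fun hw' => (hR w hw').not_gt hw,
      h.contourIntegral_inv_sub_eq_zero_of_norm_lt fun z hz => (hR z hz).trans_lt hw⟩]
    refine hK _ _ fun z hz => ?_
    rw [norm_mul, norm_inv]
    exact mul_le_mul (inv_anti₀ (sub_pos.2 hw) (hfar z hz)) (hB z hz) (norm_nonneg _)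
      (inv_nonneg.2 (sub_pos.2 hw).le)
  rw [← hHD w hw]
  exact hdiff.apply_eq_of_tendsto_cocompact w hlim

/-- The global Cauchy integral formula. -/
theorem contourIntegral_inv_sub_mul {γ : Path a a} (h : PiecewiseC1 γ) {D : Set ℂ}
    (hD : IsOpen D) {g : ℂ → ℂ} (hg : DifferentiableOn ℂ g D) (hγD : range γ ⊆ D)
    (hγ : ∀ w ∉ D, contourIntegral (fun z => (z - w)⁻¹) γ = 0) {w : ℂ} (hw : w ∈ D)
    (hwγ : w ∉ range γ) :
    contourIntegral (fun z => (z - w)⁻¹ * g z) γ =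
      g w * contourIntegral (fun z => (z - w)⁻¹) γ := by
  rw [← sub_eq_zero, ← contourIntegral_dslope_eq h (hg.continuousOn.mono hγD) hwγ]
  exact contourIntegral_dslope_eq_zero h hD hg hγD hγ hw

end Cauchy

/-! ### The logarithmic kernel and the polar terms. -/

/-- The primitive `log (z / (z - x))` vanishes at `x = 0` and never meets the branch cut: `z / (z -
x) = s ≤ 0` would force `z = -s * x / (1 - s)`, a point of `[0, 1]`. -/
theorem integral_inv_sub_ofReal_eq_log {z : ℂ} (hz : ∀ x ∈ Icc (0 : ℝ) 1, (x : ℂ) ≠ z) :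
    ∫ x in (0 : ℝ)..1, (z - x)⁻¹ = Complex.log (z / (z - 1)) := by
  have hz0 : z ≠ 0 := fun e => hz 0 (by simp) (by simp [e])
  have hne : ∀ x ∈ Icc (0 : ℝ) 1, z - x ≠ 0 := fun x hx => sub_ne_zero.2 (hz x hx).symm
  have hslit : ∀ x ∈ Icc (0 : ℝ) 1, z / (z - x) ∈ Complex.slitPlane := by
    intro x hx
    by_contra hs
    obtain ⟨s, hs0, hs⟩ : ∃ s : ℝ, s ≤ 0 ∧ (s : ℂ) = z / (z - x) := by
      rw [Complex.mem_slitPlane_iff] at hs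
      push Not at hs
      exact ⟨_, hs.1, Complex.ext rfl (by simp [hs.2])⟩
    rw [eq_div_iff (hne x hx)] at hs
    have h1s : (0 : ℝ) < 1 - s := by linarith
    have h1s' : (1 : ℂ) - s ≠ 0 := by exact_mod_cast h1s.ne'
    refine hz (-s * x / (1 - s)) ⟨div_nonneg (mul_nonneg (by linarith) hx.1) h1s.le, ?_⟩ ?_
    · rw [div_le_one h1s]; nlinarith [hx.1, hx.2]
    · push_cast
      rw [div_eq_iff h1s']
      linear_combination hs
  rw [← uIcc_of_le zero_le_one] at hne hslit
  rw [intervalIntegral.integral_eq_sub_of_hasDerivAt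
    (f := fun x : ℝ => Complex.log (z / (z - x))) (f' := fun x : ℝ => (z - x)⁻¹) (fun x hx => ?_)
    (ContinuousOn.intervalIntegrable
      ((continuous_const.sub Complex.continuous_ofReal).continuousOn.inv₀ hne))]
  · simp [hz0]
  · have h1 : HasDerivAt (fun y : ℝ => z - (y : ℂ)) (-1) x :=
      (Complex.ofRealCLM.hasDerivAt (x := x)).const_sub z
    have h2 := (h1.fun_inv (hne x hx)).const_mul z
    have h3 := HasDerivAt.clog_real (f := fun y : ℝ => z * (z - (y : ℂ))⁻¹) h2 (by
      simpa [div_eq_mul_inv] using hslit x hx)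
    have := hne x hx
    simp only [div_eq_mul_inv z]
    refine h3.congr_deriv ?_
    field_simp

/-- The contour integral of `z⁻ᵐ (z - w)⁻¹` vanishes for `m ≥ 1` along a loop with the same winding
number around `0` and `w`. -/
theorem PiecewiseC1.contourIntegral_inv_sub_mul_inv_pow {a : ℂ} {γ : Path a a}
    (h : PiecewiseC1 γ) {w : ℂ} (hw : w ≠ 0) (h0γ : 0 ∉ range γ) (hwγ : w ∉ range γ)
    (heq : contourIntegral (fun z => (z - w)⁻¹) γ = contourIntegral (fun z => z⁻¹) γ) (m : ℕ) :
    contourIntegral (fun z => (z - w)⁻¹ * (z ^ (m + 1))⁻¹) γ = 0 := by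
  have h0 : ∀ z ∈ range γ, z ≠ 0 := fun z hz e => h0γ (e ▸ hz)
  have hne : ∀ z ∈ range γ, z - w ≠ 0 := fun z hz => sub_ne_zero.2 fun e => hwγ (e ▸ hz)
  have hc : ContinuousOn (fun z => (z - w)⁻¹) (range γ) :=
    (continuousOn_id.sub continuousOn_const).inv₀ hne
  have hp : ∀ m : ℕ, ContinuousOn (fun z : ℂ => (z ^ m)⁻¹) (range γ) := fun m =>
    (continuousOn_id.pow m).inv₀ fun z hz => pow_ne_zero m (h0 z hz)
  have step : ∀ m : ℕ, contourIntegral (fun z => (z - w)⁻¹ * (z ^ (m + 1))⁻¹) γ =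
      w⁻¹ * (contourIntegral (fun z => (z - w)⁻¹ * (z ^ m)⁻¹) γ -
        contourIntegral (fun z => (z ^ (m + 1))⁻¹) γ) := by
    intro m
    rw [← h.contourIntegral_sub (F := fun z => (z - w)⁻¹ * (z ^ m)⁻¹)
      (G := fun z => (z ^ (m + 1))⁻¹) (hc.mul (hp m)) (hp (m + 1)), ← contourIntegral_const_mul]
    refine contourIntegral_congr fun z hz => ?_
    have := h0 z hz
    have := hne z hz
    field_simp
    ring
  -- Each step splits off one factor by partial fractions. At `m = 0` the winding integrals cancel;
  -- afterwards the pure power has exponent at most `-2`, hence a primitive.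
  induction m with
  | zero => rw [step 0]; simp [heq]
  | succ m ih =>
    rw [step, ih, h.contourIntegral_eq_sub_of_hasDerivAt (F := fun z => (z ^ (m + 1 + 1))⁻¹)
      (G := fun z => -(z ^ (m + 1))⁻¹ / (m + 1)) (fun z hz => ?_) (hp _), sub_self, sub_self,
      mul_zero]
    have hz0 := h0 z hz
    have hm : (m : ℂ) + 1 ≠ 0 := by exact_mod_cast m.succ_ne_zero
    refine ((((hasDerivAt_pow (m + 1) z).fun_inv
      (pow_ne_zero (m + 1) hz0)).fun_neg).div_const ((m : ℂ) + 1)).congr_deriv ?_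
    push_cast
    field_simp
    ring

/-! ### Evaluation of the finite part. -/

theorem integral_ofReal_zpow {ε : ℝ} (hε : 0 < ε) {m : ℤ} (hm : m ≠ -1) :
    ∫ x in ε..1, (x : ℂ) ^ m = (1 - (ε : ℂ) ^ (m + 1)) / (m + 1) := by
  have h0 : (0 : ℝ) ∉ uIcc ε 1 := fun h => by
    rcases le_total ε 1 with hle | hle
    · rw [uIcc_of_le hle] at h; exact absurd h.1 (not_le.2 hε)
    · rw [uIcc_of_ge hle] at h; exact absurd h.1 (by norm_num)
  have := congrArg (fun r : ℝ => (r : ℂ)) (integral_zpow (Or.inr ⟨hm, h0⟩))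
  simp only [← intervalIntegral.integral_ofReal] at this
  simpa using this

theorem hasFinitePartIntegral_of_taylor {N : ℕ} {f F : ℂ → ℂ}
    (hF : ContinuousOn (fun x : ℝ => F x) (Icc 0 1))
    (hfF : ∀ z, f z = (∑ i ∈ Finset.range (N + 1), (z ^ i / i.factorial) • iteratedDeriv i f 0) +
      z ^ (N + 1) * F z) :
    HasFinitePartIntegral (N + 1) f ((∫ x in (0 : ℝ)..1, F x)
      - ∑ k ∈ Finset.range N, iteratedDeriv k f 0 /
          ((k.factorial : ℂ) * (((N + 1 : ℕ) : ℂ) - 1 - (k : ℂ)))) := by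
  have hlim : Tendsto (fun ε : ℝ => ∫ x in ε..1, F x) (𝓝[>] 0) (𝓝 (∫ x in (0 : ℝ)..1, F x)) := by
    have hc := intervalIntegral.continuousOn_primitive_interval_left (μ := volume)
      (f := fun x : ℝ => F x) (a := 0) (b := 1)
      (by rw [uIcc_of_le zero_le_one]; exact hF.integrableOn_Icc)
    rw [uIcc_of_le zero_le_one] at hc
    refine (hc 0 (by simp)).tendsto.mono_left ?_
    rw [← nhdsWithin_Ioo_eq_nhdsGT (zero_lt_one' ℝ)]
    exact nhdsWithin_mono _ Ioo_subset_Icc_self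
  unfold HasFinitePartIntegral
  refine (hlim.sub_const _).congr' ?_
  filter_upwards [Ioo_mem_nhdsGT (zero_lt_one' ℝ)] with ε hε
  set c : ℕ → ℂ := fun k => iteratedDeriv k f 0 / k.factorial with hcdef
  have hpos : ∀ x ∈ uIcc ε 1, (0 : ℝ) < x := fun x hx => by
    rw [uIcc_of_le hε.2.le] at hx; exact hε.1.trans_le hx.1
  have hzi : ∀ m : ℤ, IntervalIntegrable (fun x : ℝ => (x : ℂ) ^ m) volume ε 1 := fun m =>
    ContinuousOn.intervalIntegrable (Complex.continuous_ofReal.continuousOn.zpow₀ m fun x hx =>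
      .inl (by exact_mod_cast (hpos x hx).ne'))
  have hFi : IntervalIntegrable (fun x : ℝ => F x) volume ε 1 :=
    ContinuousOn.intervalIntegrable (hF.mono (by
      rw [uIcc_of_le hε.2.le]; exact Icc_subset_Icc_left hε.1.le))
  have hint : ∫ x in ε..1, (x : ℂ) ^ (-((N + 1 : ℕ) : ℤ)) * f x =
      (∑ k ∈ Finset.range (N + 1), c k * ∫ x in ε..1, (x : ℂ) ^ ((k : ℤ) - ((N : ℤ) + 1))) +
        ∫ x in ε..1, F x := by
    simp only [← intervalIntegral.integral_const_mul]
    have hki : ∀ k ∈ Finset.range (N + 1), IntervalIntegrable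
        (fun x : ℝ => c k * (x : ℂ) ^ ((k : ℤ) - ((N : ℤ) + 1))) volume ε 1 :=
      fun k _ => (hzi _).const_mul _
    rw [← intervalIntegral.integral_finsetSum hki, ← intervalIntegral.integral_add
      (by simpa only [Finset.sum_fn] using IntervalIntegrable.sum _ hki) hFi]
    refine intervalIntegral.integral_congr fun x hx => ?_
    have hx0 : (x : ℂ) ≠ 0 := by exact_mod_cast (hpos x hx).ne'
    simp only [hfF x, mul_add, Finset.mul_sum]
    congr 1
    · refine Finset.sum_congr rfl fun k _ => ?_
      rw [zpow_neg, zpow_natCast, zpow_sub₀ hx0, zpow_natCast, hcdef, smul_eq_mul,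
        ← Nat.cast_succ, zpow_natCast, Nat.succ_eq_add_one]
      ring
    · rw [zpow_neg, zpow_natCast, inv_mul_cancel_left₀ (pow_ne_zero _ hx0)]
  have hlog : ∫ x in ε..1, (x : ℂ) ^ ((N : ℤ) - ((N : ℤ) + 1)) = -(Real.log ε : ℂ) := by
    have := congrArg (fun r : ℝ => (r : ℂ)) (integral_inv_of_pos hε.1 one_pos)
    simp only [← intervalIntegral.integral_ofReal] at this
    simpa using this
  -- The top term `k = N` is the multiple of `x⁻¹`; its logarithm cancels the logarithmic
  -- counterterm.
  rw [hint, Finset.sum_range_succ, hlog, Nat.add_sub_cancel]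
  have hsum : ∑ k ∈ Finset.range N, c k * ∫ x in ε..1, (x : ℂ) ^ ((k : ℤ) - ((N : ℤ) + 1)) =
      (∑ k ∈ Finset.range N, (ε : ℂ) ^ ((k : ℤ) + 1 - ((N + 1 : ℕ) : ℤ)) /
        ((k.factorial : ℂ) * (((N + 1 : ℕ) : ℂ) - 1 - (k : ℂ))) * iteratedDeriv k f 0) -
      ∑ k ∈ Finset.range N, iteratedDeriv k f 0 /
        ((k.factorial : ℂ) * (((N + 1 : ℕ) : ℂ) - 1 - (k : ℂ))) := by
    rw [← Finset.sum_sub_distrib]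
    refine Finset.sum_congr rfl fun k hk => ?_
    have hkN := Finset.mem_range.1 hk
    have hd : (N : ℂ) - k ≠ 0 := sub_ne_zero.2 (by exact_mod_cast hkN.ne')
    have hd' : (k : ℂ) - N ≠ 0 := by rw [← neg_sub]; exact neg_ne_zero.2 hd
    have hk0 : (k.factorial : ℂ) ≠ 0 := by exact_mod_cast k.factorial_ne_zero
    rw [integral_ofReal_zpow hε.1 (by omega)]
    have he : (k : ℤ) - ((N : ℤ) + 1) + 1 = (k : ℤ) + 1 - ((N + 1 : ℕ) : ℤ) := by push_cast; ring
    rw [he]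
    generalize (ε : ℂ) ^ ((k : ℤ) + 1 - ((N + 1 : ℕ) : ℤ)) = e
    push_cast
    rw [show (k : ℂ) - (N + 1) + 1 = -(N - k) by ring,
      show (N : ℂ) + 1 - 1 - k = N - k by ring, hcdef]
    field_simp
    ring
  rw [hsum, hcdef]
  ring

/-! ### The main theorem. -/

theorem theorem1 (n : ℕ) (hn : 1 ≤ n) (D : Set ℂ) (hDo : IsOpen D) (hDc : IsConnected D)
    (h01 : ∀ x ∈ Icc (0 : ℝ) 1, (x : ℂ) ∈ D)
    (f : ℂ → ℂ) (hf : AnalyticOnNhd ℂ f D)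
    (z₀ : ℂ) (C : Path z₀ z₀) (hC : PiecewiseC1 C) (hCD : range C ⊆ D)
    (hCin : ∀ w ∉ D, windingNumber C w = 0)
    (hCenc : EncirclesUnitInterval C) :
    HasFinitePartIntegral n f
      ((2 * Real.pi * Complex.I)⁻¹ *
          contourIntegral
            (fun z => z ^ (-(n : ℤ)) * f z * Complex.log (z / (z - 1))) C
        - ∑ k ∈ Finset.range (n - 1),
            iteratedDeriv k f 0 / ((k.factorial : ℂ) * ((n : ℂ) - 1 - (k : ℂ)))) := by
  obtain ⟨N, rfl⟩ : ∃ N, n = N + 1 := ⟨n - 1, by omega⟩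
  have h0D : (0 : ℂ) ∈ D := by simpa using h01 0 (by simp)
  obtain ⟨F, hF0, hfF⟩ := (hf 0 h0D).exists_eq_sum_add_pow_mul (N + 1)
  replace hfF : ∀ z, f z = (∑ i ∈ Finset.range (N + 1),
      (z ^ i / i.factorial) • iteratedDeriv i f 0) + z ^ (N + 1) * F z := hfF
  have hFD : DifferentiableOn ℂ F D := by
    intro z hz
    rcases eq_or_ne z 0 with rfl | hz0
    · exact hF0.differentiableAt.differentiableWithinAt
    · refine DifferentiableAt.differentiableWithinAt ?_
      have hfz := (hf z hz).differentiableAt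
      refine DifferentiableAt.congr_of_eventuallyEq (f := fun z => (f z -
        ∑ i ∈ Finset.range (N + 1), (z ^ i / i.factorial) • iteratedDeriv i f 0) / z ^ (N + 1))
        (DifferentiableAt.fun_div (by fun_prop) (by fun_prop) (pow_ne_zero _ hz0)) ?_
      filter_upwards [isOpen_ne.mem_nhds hz0] with w hw
      rw [hfF w, add_sub_cancel_left, mul_div_cancel_left₀ _ (pow_ne_zero _ hw)]
  have hpi : (2 * Real.pi * Complex.I : ℂ) ≠ 0 := by simp [Real.pi_ne_zero]
  have hCx : ∀ x ∈ Icc (0 : ℝ) 1,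
      contourIntegral (fun z => (z - (x : ℂ))⁻¹) C = 2 * Real.pi * Complex.I := fun x hx => by
    have := (hCenc x hx).2
    rw [windingNumber, inv_mul_eq_iff_eq_mul₀ hpi, mul_one] at this
    exact this
  have hC0 : contourIntegral (fun z => z⁻¹) C = 2 * Real.pi * Complex.I := by
    simpa using hCx 0 (by simp)
  have h0C : (0 : ℂ) ∉ range C := by simpa using (hCenc 0 (by simp)).1
  have hCout : ∀ w ∉ D, contourIntegral (fun z => (z - w)⁻¹) C = 0 := fun w hw =>
    (mul_eq_zero.1 (hCin w hw)).resolve_left (inv_ne_zero hpi)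
  have hz0 : ∀ z ∈ range C, z ≠ 0 := fun z hz e => h0C (e ▸ hz)
  have hzx : ∀ z ∈ range C, ∀ x ∈ Icc (0 : ℝ) 1, z - x ≠ 0 := fun z hz x hx =>
    sub_ne_zero.2 fun e => (hCenc x hx).1 (e ▸ hz)
  have hFc : ContinuousOn F (range C) := hFD.continuousOn.mono hCD
  have hcx : ∀ x ∈ Icc (0 : ℝ) 1, ContinuousOn (fun z => (z - (x : ℂ))⁻¹) (range C) :=
    fun x hx => (continuousOn_id.sub continuousOn_const).inv₀ fun z hz => hzx z hz x hx
  -- The point `x = 0` is left out because the vanishing of the polar terms uses `x ≠ 0`; the outer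
  -- integral does not see it.
  have inner : ∀ x ∈ Ioc (0 : ℝ) 1,
      contourIntegral (fun z => (z - (x : ℂ))⁻¹ * (z ^ (-((N + 1 : ℕ) : ℤ)) * f z)) C =
        2 * Real.pi * Complex.I * F x := by
    intro x hx
    have hx' := Ioc_subset_Icc_self hx
    have hterm : ∀ k ∈ Finset.range (N + 1), ContinuousOn
        (fun z : ℂ => iteratedDeriv k f 0 / k.factorial *
          ((z - (x : ℂ))⁻¹ * (z ^ (N - k + 1))⁻¹)) (range C) := fun k _ =>
      continuousOn_const.mul ((hcx x hx').mul
        ((continuousOn_id.pow _).inv₀ fun z hz => pow_ne_zero _ (hz0 z hz)))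
    rw [contourIntegral_congr (G := fun z => (∑ k ∈ Finset.range (N + 1),
        iteratedDeriv k f 0 / k.factorial * ((z - (x : ℂ))⁻¹ * (z ^ (N - k + 1))⁻¹)) +
          (z - (x : ℂ))⁻¹ * F z) fun z hz => ?_,
      hC.contourIntegral_add (G := fun z => (z - (x : ℂ))⁻¹ * F z)
        (continuousOn_finsetSum _ hterm) ((hcx x hx').mul hFc),
      hC.contourIntegral_sum _ hterm, Finset.sum_eq_zero fun k _ => ?_, zero_add,
      contourIntegral_inv_sub_mul hC hDo hFD hCD hCout (h01 x hx') (hCenc x hx').1, hCx x hx',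
      mul_comm]
    · rw [contourIntegral_const_mul, hC.contourIntegral_inv_sub_mul_inv_pow
        (by exact_mod_cast hx.1.ne') h0C (hCenc x hx').1 ((hCx x hx').trans hC0.symm), mul_zero]
    · have hz := hz0 z hz
      simp only [hfF z, mul_add, Finset.mul_sum]
      congr 1
      · refine Finset.sum_congr rfl fun k hk => ?_
        have hk : N + 1 = (N - k + 1) + k := by have := Finset.mem_range.1 hk; omega
        rw [zpow_neg, zpow_natCast, smul_eq_mul]
        conv_lhs => rw [hk, pow_add, mul_inv]
        field_simp
      · rw [zpow_neg, zpow_natCast, inv_mul_cancel_left₀ (pow_ne_zero _ hz)]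
  have outer : contourIntegral
      (fun z => z ^ (-((N + 1 : ℕ) : ℤ)) * f z * Complex.log (z / (z - 1))) C =
      2 * Real.pi * Complex.I * ∫ x in (0 : ℝ)..1, F x := by
    rw [contourIntegral_congr (G := fun z => ∫ x in (0 : ℝ)..1,
        (z - (x : ℂ))⁻¹ * (z ^ (-((N + 1 : ℕ) : ℤ)) * f z)) fun z hz => ?_,
      hC.contourIntegral_intervalIntegral_swap, ← intervalIntegral.integral_const_mul]
    · refine intervalIntegral.integral_congr_ae (.of_forall fun x hx => ?_)
      rw [uIoc_of_le zero_le_one] at hx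
      exact inner x hx
    · refine ContinuousOn.mul (ContinuousOn.inv₀ (by fun_prop) fun p hp => hzx _ hp.2 _ hp.1) ?_
      refine ContinuousOn.comp (g := fun z => z ^ (-((N + 1 : ℕ) : ℤ)) * f z) (f := Prod.snd)
        (t := range C) ?_ continuousOn_snd fun p hp => hp.2
      exact (continuousOn_id.zpow₀ _ fun z hz => .inl (hz0 z hz)).mul
        (hf.continuousOn.mono hCD)
    · simp only [intervalIntegral.integral_mul_const]
      rw [integral_inv_sub_ofReal_eq_log fun x hx e => (hCenc x hx).1 (e ▸ hz), mul_comm]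
  rw [outer, inv_mul_cancel_left₀ hpi]
  exact hasFinitePartIntegral_of_taylor
    (hFD.continuousOn.comp Complex.continuous_ofReal.continuousOn h01) hfF
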